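/- Let $\Omega\subset\mathbf{R}^2$ be a domain (a non-empty connected open set) whose closure $\overline\Omega$ is compact and whose boundary $\partial\Omega$ is smooth. Let $\Psi:\overline\Omega\to\mathbf{R}$ be a $C^2$ function (up to the boundary) whose graph $\Gamma_\Psi=\{(x,y,\Psi(x,y)) : (x,y)\in\overline\Omega\}$ is space-like in the Lorentz–Minkowski space $\mathbf{L}^3=(\mathbf{R}^3,\ \langle p,q\rangle_L=p_1q_1+p_2q_2-p_3q_3)$, i.e. the metric that $\langle\cdot,\cdot\rangle_L$ induces on $\Gamma_\Psi$ is positive definite at every point of $\overline\Omega$. Then the maximum $m_\Omega:=\max_{\overline\Omega}|\nabla\Psi|$ exists and satisfies $m_\Omega<1$, the length $L(\partial\Omega)$ is finite, and the mean curvature $H$ of $\Gamma_\Psi$ (half the trace of the second fundamental form with respect to a unit normal field) satisfies $$\min_{\overline{\Omega}} |H| \le \frac12\,\frac{m_\Omega}{\sqrt{1-m_\Omega^2}}\,\frac{L(\partial\Omega)}{A(\overline\Omega)},$$ where $L(\partial\Omega)$ is the length of $\partial\Omega$, $A(\overline\Omega)$ is the area of $\overline\Omega$, and the minimum is attained. 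-/

import Mathlib

open MeasureTheory
open scoped ContDiff

noncomputable section

/-- The Lorentz metric `p₁q₁ + p₂q₂ - p₃q₃` of Lorentz-Minkowski 3-space. -/
def lorentzInner (p q : EuclideanSpace ℝ (Fin 3)) : ℝ :=
  p 0 * q 0 + p 1 * q 1 - p 2 * q 2

/-- The Lorentz cross product: the vector `u × v` with
`⟨u × v, w⟩_L = det (u, v, w)` for all `w`. In particular it is Lorentz-orthogonal
to `u` and `v`. -/
def lorentzCross (u v : EuclideanSpace ℝ (Fin 3)) : EuclideanSpace ℝ (Fin 3) :=
  !₂[u 1 * v 2 - u 2 * v 1, u 2 * v 0 - u 0 * v 2, -(u 0 * v 1 - u 1 * v 0)]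

/-- The parametrization `(x, y) ↦ (x, y, Ψ(x, y))` of the graph of `Ψ`. -/
def graphMap (Ψ : EuclideanSpace ℝ (Fin 2) → ℝ) (x : EuclideanSpace ℝ (Fin 2)) :
    EuclideanSpace ℝ (Fin 3) :=
  !₂[x 0, x 1, Ψ x]

/-- `X` is space-like on `S`: the induced metric `X^*⟨·,·⟩_L` is positive definite at every
point of `S`. Derivatives are taken within `S`, so that `S` may be the closure of a domain
with smooth boundary, where derivatives at boundary points are one-sided. -/
def IsSpacelikeOn (X : EuclideanSpace ℝ (Fin 2) → EuclideanSpace ℝ (Fin 3))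
    (S : Set (EuclideanSpace ℝ (Fin 2))) : Prop :=
  ∀ x ∈ S, ∀ v : EuclideanSpace ℝ (Fin 2), v ≠ 0 →
    0 < lorentzInner (fderivWithin ℝ X S x v) (fderivWithin ℝ X S x v)

/-- The partial derivative `∂X/∂xᵢ` of a map, taken within `S`. -/
def partialWithin (S : Set (EuclideanSpace ℝ (Fin 2))) (i : Fin 2)
    (X : EuclideanSpace ℝ (Fin 2) → EuclideanSpace ℝ (Fin 3))
    (x : EuclideanSpace ℝ (Fin 2)) : EuclideanSpace ℝ (Fin 3) :=
  fderivWithin ℝ X S x (EuclideanSpace.single i 1)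

/-- Coefficients `gᵢⱼ = ⟨Xᵢ, Xⱼ⟩_L` of the first fundamental form. -/
def firstForm (X : EuclideanSpace ℝ (Fin 2) → EuclideanSpace ℝ (Fin 3))
    (S : Set (EuclideanSpace ℝ (Fin 2))) (x : EuclideanSpace ℝ (Fin 2)) (i j : Fin 2) : ℝ :=
  lorentzInner (partialWithin S i X x) (partialWithin S j X x)

/-- The unit normal field `ν` of a space-like surface: it is time-like, `⟨ν, ν⟩_L = -1`. -/
def unitNormal (X : EuclideanSpace ℝ (Fin 2) → EuclideanSpace ℝ (Fin 3))
    (S : Set (EuclideanSpace ℝ (Fin 2))) (x : EuclideanSpace ℝ (Fin 2)) :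
    EuclideanSpace ℝ (Fin 3) :=
  let n := lorentzCross (partialWithin S 0 X x) (partialWithin S 1 X x)
  (√(-lorentzInner n n))⁻¹ • n

/-- Coefficients `hᵢⱼ = ⟨Xᵢⱼ, ν⟩_L` of the second fundamental form. -/
def secondForm (X : EuclideanSpace ℝ (Fin 2) → EuclideanSpace ℝ (Fin 3))
    (S : Set (EuclideanSpace ℝ (Fin 2))) (x : EuclideanSpace ℝ (Fin 2)) (i j : Fin 2) : ℝ :=
  lorentzInner (partialWithin S j (partialWithin S i X) x) (unitNormal X S x)

/-- The mean curvature: half the trace of the second fundamental form with respect to the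
first one, `H = (h₁₁ g₂₂ - 2 h₁₂ g₁₂ + h₂₂ g₁₁) / (2 (g₁₁ g₂₂ - g₁₂²))`. -/
def meanCurvature (X : EuclideanSpace ℝ (Fin 2) → EuclideanSpace ℝ (Fin 3))
    (S : Set (EuclideanSpace ℝ (Fin 2))) (x : EuclideanSpace ℝ (Fin 2)) : ℝ :=
  (secondForm X S x 0 0 * firstForm X S x 1 1 - 2 * secondForm X S x 0 1 * firstForm X S x 0 1
      + secondForm X S x 1 1 * firstForm X S x 0 0) /
    (2 * (firstForm X S x 0 0 * firstForm X S x 1 1 - firstForm X S x 0 1 ^ 2))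

/-- A set `Ω` in the plane has smooth boundary: near every boundary point it is the sublevel
set `{ρ < 0}` of a smooth function `ρ` with non-vanishing differential at that point. -/
def HasSmoothBoundary (Ω : Set (EuclideanSpace ℝ (Fin 2))) : Prop :=
  ∀ p ∈ frontier Ω, ∃ (U : Set (EuclideanSpace ℝ (Fin 2))) (ρ : EuclideanSpace ℝ (Fin 2) → ℝ),
    IsOpen U ∧ p ∈ U ∧ ContDiffOn ℝ ∞ ρ U ∧ ρ p = 0 ∧ fderiv ℝ ρ p ≠ 0 ∧
      Ω ∩ U = {x ∈ U | ρ x < 0}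

end

/-! The mean curvature is a divergence: with `F = ∇Ψ / √(1 - |∇Ψ|²)` one has `div F = 2H` in `Ω`
(`divergence_curvatureField`). Since `t / √(1 - t²)` increases on `[0, 1)`, `|F| ≤ M = m / √(1 -
m²)`, so the flux of `F` through the boundary is at most `M L(∂Ω)`, whence `2 |∫ H| ≤ M L(∂Ω)`. If
`min |H| = 0` there is nothing to prove. Otherwise the continuous function `H` has constant sign on
the connected set `Ω`, so `min |H| · A ≤ |∫ H|` (`mul_volume_le_abs_setIntegral`).

The analytic core is the flux inequality `abs_setIntegral_divergence_le`, with length measured by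
the Hausdorff measure. Being only an inequality, it needs neither a surface integral nor the arc
length formula. For each `δ > 0` the boundary is covered by rectangles in which `Ω` lies below a
graph of slope at most `δ`. There the flux is an integral over the graph parameter `s` against `b 1
- g' b 0`, a vector of norm at most `1 + δ`, and `ds` is dominated by length because projection to
the axis is `1`-Lipschitz. A partition of unity adds up the pieces, interior pieces contribute zero,
and `δ → 0` removes the factor `1 + δ`. -/

open Set Filter Topology

/-! ### Boundary charts: the domain as a local subgraph. -/

/-- The Euclidean plane. -/
abbrev Plane := EuclideanSpace ℝ (Fin 2)

/-- The chart `(s, τ) ↦ p + s b₀ + (g s + τ) b₁`, which straightens the graph of `g` in the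
frame `b` based at `p`. -/
noncomputable def graphChart (p : Plane) (b : OrthonormalBasis (Fin 2) ℝ Plane) (g : ℝ → ℝ) (z : ℝ × ℝ) :
    Plane :=
  p + z.1 • b 0 + (g z.1 + z.2) • b 1

/-- The open coordinate rectangle around `p` with half sides `r` and `R` in the frame `b`. -/
def frameBox (p : Plane) (b : OrthonormalBasis (Fin 2) ℝ Plane) (r R : ℝ) : Set Plane :=
  {x | |inner ℝ (b 0) (x - p)| < r ∧ |inner ℝ (b 1) (x - p)| < R}

/-- In a coordinate rectangle around `p`, the set `Ω` is the region below the graph of a `C²`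
function `g` whose slope is at most `δ`. -/
structure IsLocalSubgraph (Ω : Set Plane) (p : Plane) (b : OrthonormalBasis (Fin 2) ℝ Plane)
    (g : ℝ → ℝ) (r R δ : ℝ) : Prop where
  r_pos : 0 < r
  R_pos : 0 < R
  contDiff : ContDiff ℝ 2 g
  abs_lt : ∀ s ∈ Icc (-r) r, |g s| < R
  abs_deriv_le : ∀ s ∈ Icc (-r) r, |deriv g s| ≤ δ
  mem_iff : ∀ s ∈ Icc (-r) r, ∀ t ∈ Icc (-R) R, p + s • b 0 + t • b 1 ∈ Ω ↔ t < g s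

theorem isOpen_frameBox (p : Plane) (b : OrthonormalBasis (Fin 2) ℝ Plane) (r R : ℝ) :
    IsOpen (frameBox p b r R) := by
  have h : ∀ i, Continuous fun x => |inner ℝ (b i) (x - p)| := fun i => by fun_prop
  exact (isOpen_lt (h 0) continuous_const).inter (isOpen_lt (h 1) continuous_const)

theorem mem_frameBox_self (p : Plane) (b : OrthonormalBasis (Fin 2) ℝ Plane) {r R : ℝ}
    (hr : 0 < r) (hR : 0 < R) : p ∈ frameBox p b r R := by
  simp [frameBox, hr, hR]

theorem inner_zero_frame (p : Plane) (b : OrthonormalBasis (Fin 2) ℝ Plane) (s t : ℝ) :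
    inner ℝ (b 0) (p + s • b 0 + t • b 1 - p) = s := by
  rw [show p + s • b 0 + t • b 1 - p = s • b 0 + t • b 1 by abel]
  simp [inner_add_right, inner_smul_right, b.inner_eq_ite]

theorem inner_one_frame (p : Plane) (b : OrthonormalBasis (Fin 2) ℝ Plane) (s t : ℝ) :
    inner ℝ (b 1) (p + s • b 0 + t • b 1 - p) = t := by
  rw [show p + s • b 0 + t • b 1 - p = s • b 0 + t • b 1 by abel]
  simp [inner_add_right, inner_smul_right, b.inner_eq_ite]

theorem frame_expansion (p : Plane) (b : OrthonormalBasis (Fin 2) ℝ Plane) (x : Plane) :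
    p + inner ℝ (b 0) (x - p) • b 0 + inner ℝ (b 1) (x - p) • b 1 = x := by
  have h := b.sum_repr' (x - p)
  rw [Fin.sum_univ_two] at h
  rw [add_assoc, h]
  abel

theorem graphChart_mem_frameBox_iff (p : Plane) (b : OrthonormalBasis (Fin 2) ℝ Plane)
    (g : ℝ → ℝ) (r R : ℝ) (z : ℝ × ℝ) :
    graphChart p b g z ∈ frameBox p b r R ↔ |z.1| < r ∧ |g z.1 + z.2| < R := by
  simp only [frameBox, graphChart, mem_ofPred_eq, inner_zero_frame, inner_one_frame]

/-- A smooth boundary defining function makes the set a local subgraph with small slope. -/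
theorem exists_isLocalSubgraph {Ω U : Set Plane} {ρ : Plane → ℝ} {p : Plane} (hU : IsOpen U)
    (hpU : p ∈ U) (hρ : ContDiffOn ℝ ∞ ρ U) (hρp : ρ p = 0) (hdρ : fderiv ℝ ρ p ≠ 0)
    (hΩU : Ω ∩ U = {x ∈ U | ρ x < 0}) {δ : ℝ} (hδ : 0 < δ) :
    ∃ b g r R, IsLocalSubgraph Ω p b g r R δ := by
  set w : Plane := gradient ρ p with hw
  have hwv : ∀ v, fderiv ℝ ρ p v = inner ℝ w v := fun v => by
    rw [hw, gradient, InnerProductSpace.toDual_symm_apply]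
  have hw0 : w ≠ 0 := fun h0 => hdρ (by ext v; simp [hwv, h0])
  have hwn : 0 < ‖w‖ := norm_pos_iff.2 hw0
  -- The second axis points along `∇ρ`, so `ρ` increases in that direction and `Ω` lies below the
  -- graph.
  obtain ⟨b, hb⟩ : ∃ b : OrthonormalBasis (Fin 2) ℝ Plane, b 1 = ‖w‖⁻¹ • w := by
    obtain ⟨b, hb⟩ := Orthonormal.exists_orthonormalBasis_extension_of_card_eq
      (𝕜 := ℝ) (E := Plane) (ι := Fin 2) (by simp) (v := fun _ => ‖w‖⁻¹ • w) (s := {1}) (by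
        constructor
        · intro i
          simp [norm_smul, hwn.ne']
        · intro i j hij
          exact absurd (Subsingleton.elim i j) hij)
    exact ⟨b, hb 1 rfl⟩
  have hw1 : w = ‖w‖ • b 1 := by rw [hb, smul_smul, mul_inv_cancel₀ hwn.ne', one_smul]
  set P : ℝ × ℝ → Plane := fun z => p + z.1 • b 0 + z.2 • b 1 with hP
  have hPc : ContDiff ℝ ∞ P := by fun_prop
  have hP0 : P (0, 0) = p := by simp [hP]
  set f : ℝ × ℝ → ℝ := fun z => ρ (P z) with hf
  have hfU : ∀ z, P z ∈ U → ContDiffAt ℝ 2 f z := fun z hz =>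
    (((hρ.contDiffAt (hU.mem_nhds hz)).comp z hPc.contDiffAt)).of_le
      (WithTop.coe_le_coe.2 le_top : ((2 : ℕ∞) : WithTop ℕ∞) ≤ ((⊤ : ℕ∞) : WithTop ℕ∞))
  have hf0 : ContDiffAt ℝ 2 f (0, 0) := hfU _ (by rwa [hP0])
  have hPd : ∀ z, HasFDerivAt P ((ContinuousLinearMap.fst ℝ ℝ ℝ).smulRight (b 0) +
      (ContinuousLinearMap.snd ℝ ℝ ℝ).smulRight (b 1)) z := fun z => by
    have h1 := ((ContinuousLinearMap.fst ℝ ℝ ℝ).smulRight (b 0)).hasFDerivAt (x := z)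
    have h2 := ((ContinuousLinearMap.snd ℝ ℝ ℝ).smulRight (b 1)).hasFDerivAt (x := z)
    exact (h1.const_add p).add h2
  have hfd : ∀ v, fderiv ℝ f (0, 0) v = v.2 * ‖w‖ := fun v => by
    have h1 : HasFDerivAt ρ (fderiv ℝ ρ p) (P (0, 0)) := by
      rw [hP0]
      exact ((hρ.contDiffAt (hU.mem_nhds hpU)).differentiableAt (by simp)).hasFDerivAt
    have h2 := (h1.comp (0, 0) (hPd (0, 0))).fderiv
    have h3 : fderiv ℝ f (0, 0) v = fderiv ℝ ρ p (v.1 • b 0 + v.2 • b 1) := by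
      rw [show f = ρ ∘ P from rfl, h2]; rfl
    rw [h3, hwv, hw1]
    simp [inner_add_right, inner_smul_right, inner_smul_left, b.inner_eq_ite, norm_smul]
  have hinv : (fderiv ℝ f (0, 0) ∘L .inr ℝ ℝ ℝ).IsInvertible := by
    refine ⟨ContinuousLinearEquiv.unitsEquivAut ℝ (Units.mk0 ‖w‖ hwn.ne'), ?_⟩
    ext
    simp [hfd]
  set ψ := hf0.implicitFunction two_ne_zero hinv with hψ
  have hψ0 : ψ 0 = 0 := hf0.implicitFunction_apply_self two_ne_zero hinv
  have hψe : ∀ᶠ x in 𝓝 (0 : ℝ), f (x, ψ x) = 0 := by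
    have := hf0.eventually_apply_implicitFunction two_ne_zero hinv
    simpa [hf, hP0, hρp] using this
  have hψc : ContDiffAt ℝ 2 ψ 0 := hf0.contDiffAt_implicitFunction two_ne_zero hinv
  -- The first axis is tangent to `{ρ = 0}`, so the slope vanishes at `0` and is below `δ` nearby.
  have hψd : HasDerivAt ψ 0 0 := by
    have h : HasDerivAt ψ _ 0 :=
      (hf0.hasStrictFDerivAt_implicitFunction two_ne_zero hinv).hasFDerivAt.hasDerivAt
    exact h.congr_deriv (by simp [hfd])
  obtain ⟨η, hη, hηψ⟩ := Metric.eventually_nhds_iff.1 (hψc.eventually (by simp))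
  -- The implicit function is known to be `C²` only within distance `η`; the cutoff gives a globally
  -- `C²` function with the same germ at `0`.
  let χ : ContDiffBump (0 : ℝ) := ⟨η / 4, η / 2, by positivity, by linarith⟩
  set g : ℝ → ℝ := fun s => χ s * ψ s with hg
  have hgc : ContDiff ℝ 2 g := by
    refine contDiff_iff_contDiffAt.2 fun x => ?_
    by_cases hx : x ∈ tsupport g
    swap
    · exact contDiffAt_const.congr_of_eventuallyEq (notMem_tsupport_iff_eventuallyEq.1 hx)
    have hx' : x ∈ tsupport χ := closure_mono (fun y hy => left_ne_zero_of_mul hy) hx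
    rw [χ.tsupport_eq] at hx'
    refine χ.contDiffAt.mul (hηψ ?_)
    have := Metric.mem_closedBall.1 hx'
    change dist x 0 ≤ η / 2 at this
    linarith
  have hgψ : g =ᶠ[𝓝 0] ψ := by
    filter_upwards [χ.eventuallyEq_one] with s hs
    simp [hg, hs]
  have hg0 : g 0 = 0 := by rw [hgψ.eq_of_nhds, hψ0]
  have hgd0 : deriv g 0 = 0 := by rw [hgψ.deriv_eq, hψd.deriv]
  have hdt : ∀ᶠ z in 𝓝 ((0 : ℝ), (0 : ℝ)), 0 < fderiv ℝ f z (0, 1) := by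
    have h1 : ContinuousAt (fun z => fderiv ℝ f z (0, 1)) (0, 0) :=
      (hf0.continuousAt_fderiv (by simp)).clm_apply continuousAt_const
    refine h1.eventually_const_lt ?_
    simpa [hfd] using hwn
  have hPU : ∀ᶠ z in 𝓝 ((0 : ℝ), (0 : ℝ)), P z ∈ U :=
    hPc.continuous.continuousAt.eventually_mem (hU.mem_nhds (by rwa [hP0]))
  obtain ⟨ε, hε, hεz⟩ := Metric.eventually_nhds_iff.1 (hdt.and hPU)
  have hsmall : ∀ᶠ s in 𝓝 (0 : ℝ), |g s| < ε / 2 ∧ |deriv g s| < δ ∧ f (s, g s) = 0 := by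
    refine ((hgc.continuous.abs.tendsto' 0 0 (by simp [hg0])).eventually_lt_const
      (by positivity)).and (((hgc.continuous_deriv (by simp)).abs.tendsto' 0 0
        (by simp [hgd0])).eventually_lt_const hδ |>.and ?_)
    filter_upwards [hψe, hgψ] with s h1 h2
    rw [h2, h1]
  obtain ⟨r₀, hr₀, hr₀s⟩ := Metric.eventually_nhds_iff.1 hsmall
  have hs_lt : ∀ s ∈ Icc (-(min (ε / 2) (r₀ / 2))) (min (ε / 2) (r₀ / 2)),
      |s| ≤ ε / 2 ∧ |s| ≤ r₀ / 2 := fun s hs => by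
    have := abs_le.2 hs
    exact ⟨this.trans (min_le_left _ _), this.trans (min_le_right _ _)⟩
  have hgood : ∀ s ∈ Icc (-(min (ε / 2) (r₀ / 2))) (min (ε / 2) (r₀ / 2)),
      |g s| < ε / 2 ∧ |deriv g s| < δ ∧ f (s, g s) = 0 := fun s hs =>
    hr₀s (by rw [Real.dist_0_eq_abs]; linarith [(hs_lt s hs).2])
  -- Sides at most `ε / 2` keep the rectangle in the sup-norm ball where `f` increases in `t`; the
  -- bound `r₀ / 2` keeps the graph strictly inside the height `ε / 2`.
  refine ⟨b, g, min (ε / 2) (r₀ / 2), ε / 2, by positivity, by positivity, hgc,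
    fun s hs => (hgood s hs).1, fun s hs => (hgood s hs).2.1.le, fun s hs t ht => ?_⟩
  have hbox : ∀ t ∈ Icc (-(ε / 2)) (ε / 2), 0 < fderiv ℝ f (s, t) (0, 1) ∧ P (s, t) ∈ U :=
    fun t ht => hεz (by
      rw [Prod.dist_eq, Real.dist_0_eq_abs, Real.dist_0_eq_abs]
      exact max_lt (by linarith [(hs_lt s hs).1]) (by linarith [abs_le.2 ht]))
  have hder : ∀ t ∈ Icc (-(ε / 2)) (ε / 2),
      HasDerivAt (fun t => f (s, t)) (fderiv ℝ f (s, t) (0, 1)) t := fun t ht => by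
    have h1 := ((hfU _ (hbox t ht).2).differentiableAt (by simp)).hasFDerivAt
    exact h1.comp_hasDerivAt t ((hasDerivAt_const t s).prodMk (hasDerivAt_id t))
  have hmono : StrictMonoOn (fun t => f (s, t)) (Icc (-(ε / 2)) (ε / 2)) := by
    refine strictMonoOn_of_deriv_pos (convex_Icc _ _)
      (fun t ht => (hder t ht).continuousAt.continuousWithinAt) fun t ht => ?_
    rw [(hder t (interior_subset ht)).deriv]
    exact (hbox t (interior_subset ht)).1
  have hgs : g s ∈ Icc (-(ε / 2)) (ε / 2) := abs_le.1 (hgood s hs).1.le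
  have hiff : P (s, t) ∈ Ω ↔ ρ (P (s, t)) < 0 := by
    have h : P (s, t) ∈ Ω ∩ U ↔ P (s, t) ∈ {x ∈ U | ρ x < 0} := by rw [hΩU]
    simpa [(hbox t ht).2] using h
  refine hiff.trans ?_
  have h := hmono.lt_iff_lt ht hgs
  simp only [(hgood s hs).2.2] at h
  exact h

/-! ### The divergence theorem below a graph. -/

/-- The divergence of a planar vector field. -/
noncomputable def divergence (G : Plane → Plane) (x : Plane) : ℝ :=
  LinearMap.trace ℝ Plane (fderiv ℝ G x)

theorem divergence_eq_sum_inner (b : OrthonormalBasis (Fin 2) ℝ Plane) (G : Plane → Plane)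
    (x : Plane) : divergence G x =
      inner ℝ (b 0) (fderiv ℝ G x (b 0)) + inner ℝ (b 1) (fderiv ℝ G x (b 1)) := by
  rw [divergence, LinearMap.trace_eq_sum_inner _ b, Fin.sum_univ_two]
  rfl

theorem divergence_of_notMem_tsupport {G : Plane → Plane} {x : Plane} (hx : x ∉ tsupport G) :
    divergence G x = 0 := by
  rw [divergence, fderiv_of_notMem_tsupport ℝ hx]
  simp

theorem graphChart_hasFDerivAt (p : Plane) (b : OrthonormalBasis (Fin 2) ℝ Plane) {g : ℝ → ℝ}
    {z : ℝ × ℝ} (hg : DifferentiableAt ℝ g z.1) :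
    HasFDerivAt (graphChart p b g) ((ContinuousLinearMap.fst ℝ ℝ ℝ).smulRight (b 0) +
      (deriv g z.1 • ContinuousLinearMap.fst ℝ ℝ ℝ + ContinuousLinearMap.snd ℝ ℝ ℝ).smulRight
        (b 1)) z := by
  have h1 : HasFDerivAt (fun z : ℝ × ℝ => z.1) (ContinuousLinearMap.fst ℝ ℝ ℝ) z := hasFDerivAt_fst
  have h2 : HasFDerivAt (fun z : ℝ × ℝ => z.2) (ContinuousLinearMap.snd ℝ ℝ ℝ) z := hasFDerivAt_snd
  have h3 : HasFDerivAt (fun z : ℝ × ℝ => g z.1) (deriv g z.1 • ContinuousLinearMap.fst ℝ ℝ ℝ) z :=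
    hg.hasDerivAt.comp_hasFDerivAt z h1
  exact ((h1.smul_const (b 0)).const_add p).add ((h3.add h2).smul_const (b 1))

theorem continuous_graphChart (p : Plane) (b : OrthonormalBasis (Fin 2) ℝ Plane) {g : ℝ → ℝ}
    (hg : Continuous g) : Continuous (graphChart p b g) := by
  unfold graphChart
  fun_prop

theorem injective_graphChart (p : Plane) (b : OrthonormalBasis (Fin 2) ℝ Plane) (g : ℝ → ℝ) :
    Function.Injective (graphChart p b g) := by
  intro z z' h
  have h0 := congrArg (fun x => inner ℝ (b 0) (x - p)) h
  have h1 := congrArg (fun x => inner ℝ (b 1) (x - p)) h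
  simp only [graphChart, inner_zero_frame, inner_one_frame] at h0 h1
  rw [h0] at h1
  exact Prod.ext h0 (by linarith)

/-- The chart is a shear followed by an isometry, so no Jacobian appears. -/
theorem measurePreserving_graphChart (p : Plane) (b : OrthonormalBasis (Fin 2) ℝ Plane)
    {g : ℝ → ℝ} (hg : Continuous g) : MeasurePreserving (graphChart p b g) := by
  have h1 : MeasurePreserving (fun z : ℝ × ℝ => (z.1, g z.1 + z.2)) :=
    (MeasurePreserving.id volume).skew_product (g := fun s t => g s + t) (by fun_prop)
      (Eventually.of_forall fun s => (measurePreserving_add_left volume (g s)).map_eq)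
  have h2 := (volume_preserving_finTwoArrow ℝ).symm.comp h1
  have h3 := ((measurePreserving_add_left volume p).comp
    b.measurePreserving_repr_symm).comp ((PiLp.volume_preserving_toLp (Fin 2)).comp h2)
  have he : graphChart p b g = (((fun x => p + x) ∘ b.repr.symm) ∘ WithLp.toLp 2 ∘
      MeasurableEquiv.finTwoArrow.symm ∘ fun z => (z.1, g z.1 + z.2)) := by
    funext z
    simp only [graphChart, Function.comp_apply]
    rw [add_assoc]
    congr 1
    rw [← b.sum_repr_symm]
    simp [Fin.sum_univ_two]
  rw [he]
  exact h3

theorem IsLocalSubgraph.graphChart_mem_iff {Ω : Set Plane} {p : Plane}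
    {b : OrthonormalBasis (Fin 2) ℝ Plane} {g : ℝ → ℝ} {r R δ : ℝ}
    (h : IsLocalSubgraph Ω p b g r R δ) {z : ℝ × ℝ} (h1 : |z.1| ≤ r) (h2 : |g z.1 + z.2| ≤ R) :
    graphChart p b g z ∈ Ω ↔ z.2 < 0 := by
  rw [graphChart, h.mem_iff _ (abs_le.1 h1) _ (abs_le.1 h2)]
  constructor <;> intro <;> linarith

theorem IsLocalSubgraph.graphChart_mem_closure {Ω : Set Plane} {p : Plane}
    {b : OrthonormalBasis (Fin 2) ℝ Plane} {g : ℝ → ℝ} {r R δ : ℝ}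
    (h : IsLocalSubgraph Ω p b g r R δ) {z : ℝ × ℝ} (h1 : |z.1| ≤ r) (h2 : |g z.1 + z.2| < R)
    (h3 : z.2 ≤ 0) : graphChart p b g z ∈ closure Ω := by
  have hc : ContinuousAt (fun τ : ℝ => |g z.1 + τ|) z.2 := by fun_prop
  have hS : Continuous fun τ : ℝ => graphChart p b g (z.1, τ) :=
    (continuous_graphChart p b h.contDiff.continuous).comp (by fun_prop)
  refine mem_closure_of_tendsto (f := fun τ => graphChart p b g (z.1, τ)) (b := 𝓝[<] z.2)
    ((hS.tendsto z.2).mono_left nhdsWithin_le_nhds) ?_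
  filter_upwards [nhdsWithin_le_nhds (hc.eventually_lt_const h2), self_mem_nhdsWithin] with τ h4 h5
  exact (h.graphChart_mem_iff (z := (z.1, τ)) h1 h4.le).2 (lt_of_lt_of_le h5 h3)

/-- The divergence theorem below a graph, for a field supported in a coordinate rectangle. -/
theorem IsLocalSubgraph.setIntegral_divergence {Ω : Set Plane} {p : Plane}
    {b : OrthonormalBasis (Fin 2) ℝ Plane} {g : ℝ → ℝ} {r R δ : ℝ}
    (h : IsLocalSubgraph Ω p b g r R δ) (hΩ : IsOpen Ω) {G : Plane → Plane}
    (hGc : ContinuousOn G (closure Ω)) (hGd : DifferentiableOn ℝ G Ω)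
    (hGs : tsupport G ⊆ frameBox p b r R) (hGi : IntegrableOn (divergence G) Ω) :
    ∫ x in Ω, divergence G x =
      ∫ s in (-r)..r, inner ℝ (b 1 - deriv g s • b 0) (G (graphChart p b g (s, 0))) := by
  have hr := h.r_pos
  have hR := h.R_pos
  set S := graphChart p b g with hS
  have hSc : Continuous S := continuous_graphChart p b h.contDiff.continuous
  have hSmp : MeasurePreserving S := measurePreserving_graphChart p b h.contDiff.continuous
  have hSemb : MeasurableEmbedding S := hSc.measurableEmbedding (injective_graphChart p b g)
  have hbox : ∀ z, S z ∈ tsupport G → |z.1| < r ∧ |g z.1 + z.2| < R := fun z hz =>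
    (graphChart_mem_frameBox_iff p b g r R z).1 (hGs hz)
  have hzero : ∀ z, S z ∉ tsupport G → G (S z) = 0 := fun z hz => image_eq_zero_of_notMem_tsupport hz
  have hgR : ∀ s, |s| ≤ r → |g s| < R := fun s hs => h.abs_lt s (abs_le.1 hs)
  -- On the support `|g + τ| < R` and `|g| < R`, hence `|τ| < 2R`: this depth captures all of the
  -- support below the graph.
  set Q : Set (ℝ × ℝ) := Ioo (-r) r ×ˢ Ioo (-(2 * R)) 0 with hQ
  have hQm : MeasurableSet Q := measurableSet_Ioo.prod measurableSet_Ioo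
  have hΩm : MeasurableSet (S ⁻¹' Ω) := hSc.measurable hΩ.measurableSet
  have hQΩ : ∀ z ∈ Q, S z ∈ tsupport G → S z ∈ Ω := fun z hz hzs =>
    (h.graphChart_mem_iff (hbox z hzs).1.le (hbox z hzs).2.le).2 hz.2.2
  have hΩQ : ∀ z, S z ∈ Ω → S z ∈ tsupport G → z ∈ Q := fun z hz hzs => by
    have h1 := hbox z hzs
    have h2 := (h.graphChart_mem_iff h1.1.le h1.2.le).1 hz
    have h3 := _root_.abs_lt.1 (hgR z.1 h1.1.le)
    have h4 := _root_.abs_lt.1 h1.2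
    exact ⟨_root_.abs_lt.1 h1.1, by constructor <;> linarith⟩
  have hsub1 : ∀ z ∈ S ⁻¹' Ω \ (S ⁻¹' Ω ∩ Q), divergence G (S z) = 0 := fun z hz =>
    divergence_of_notMem_tsupport fun hzs => hz.2 ⟨hz.1, hΩQ z hz.1 hzs⟩
  have hsub2 : ∀ z ∈ Q \ (S ⁻¹' Ω ∩ Q), divergence G (S z) = 0 := fun z hz =>
    divergence_of_notMem_tsupport fun hzs => hz.2 ⟨hQΩ z hz.1 hzs, hz.1⟩
  have hint : ∫ x in Ω, divergence G x = ∫ z in Q, divergence G (S z) := by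
    rw [← hSmp.setIntegral_preimage_emb hSemb,
      setIntegral_eq_of_subset_of_forall_sdiff_eq_zero hΩm inter_subset_left hsub1,
      setIntegral_eq_of_subset_of_forall_sdiff_eq_zero hQm inter_subset_right hsub2]
  have hQi : IntegrableOn (fun z => divergence G (S z)) Q := by
    have h1 : IntegrableOn (fun z => divergence G (S z)) (S ⁻¹' Ω) :=
      (hSmp.integrableOn_comp_preimage hSemb).2 hGi
    exact (h1.mono_set inter_subset_left).of_forall_sdiff_eq_zero hQm hsub2
  have hQe : Q =ᵐ[volume] Icc (-r) r ×ˢ Icc (-(2 * R)) 0 :=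
    Measure.set_prod_ae_eq Ioo_ae_eq_Icc Ioo_ae_eq_Icc
  have hQe' : Q =ᵐ[volume] Ioc (-r) r ×ˢ Ioc (-(2 * R)) 0 :=
    Measure.set_prod_ae_eq Ioo_ae_eq_Ioc Ioo_ae_eq_Ioc
  have hdg : Differentiable ℝ g := h.contDiff.differentiable (by simp)
  have hdg' : ContDiff ℝ 1 (deriv g) := h.contDiff.deriv'
  -- `(A 0, B)` is the field pulled back to the straightened chart: the `g'` terms cancel in `∂ₛ (A
  -- 0) + ∂_τ B`, leaving `div G`. Differentiating `B` uses that `g` is `C²`.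
  set A : Fin 2 → ℝ × ℝ → ℝ := fun i z => inner ℝ (b i) (G (S z)) with hA
  set B : ℝ × ℝ → ℝ := fun z => A 1 z - deriv g z.1 * A 0 z with hB
  have hGat : ∀ z ∈ Q, DifferentiableAt ℝ G (S z) := fun z hz => by
    by_cases hzs : S z ∈ tsupport G
    · exact hGd.differentiableAt (hΩ.mem_nhds (hQΩ z hz hzs))
    · exact (differentiableAt_const 0).congr_of_eventuallyEq (notMem_tsupport_iff_eventuallyEq.1 hzs)
  have hAd : ∀ i, ∀ z ∈ Q, HasFDerivAt (A i) ((innerSL ℝ (b i)).comp ((fderiv ℝ G (S z)).comp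
      ((ContinuousLinearMap.fst ℝ ℝ ℝ).smulRight (b 0) +
      (deriv g z.1 • ContinuousLinearMap.fst ℝ ℝ ℝ + ContinuousLinearMap.snd ℝ ℝ ℝ).smulRight
        (b 1)))) z := fun i z hz =>
    (innerSL ℝ (b i)).hasFDerivAt.comp z
      ((hGat z hz).hasFDerivAt.comp z (graphChart_hasFDerivAt p b (hdg z.1)))
  have hgd : ∀ z : ℝ × ℝ, HasFDerivAt (fun z : ℝ × ℝ => deriv g z.1)
      (deriv (deriv g) z.1 • ContinuousLinearMap.fst ℝ ℝ ℝ) z := fun z =>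
    ((hdg'.differentiable (by simp)) z.1).hasDerivAt.comp_hasFDerivAt z hasFDerivAt_fst
  have hBd := fun z hz => (hAd 1 z hz).sub ((hgd z).mul (hAd 0 z hz))
  have hdiv : ∀ z ∈ Q, fderiv ℝ (A 0) z (1, 0) + fderiv ℝ B z (0, 1) = divergence G (S z) := by
    intro z hz
    rw [(hAd 0 z hz).fderiv, (show HasFDerivAt B _ z from hBd z hz).fderiv,
      divergence_eq_sum_inner b]
    simp
  -- `G` is continuous only on `closure Ω`. Near support points the chart sends the closed box into
  -- it; elsewhere `G` vanishes locally.
  have hAc : ∀ i, ContinuousOn (A i) (Icc (-r) r ×ˢ Icc (-(2 * R)) 0) := by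
    intro i
    suffices hc : ContinuousOn (fun z => G (S z)) (Icc (-r) r ×ˢ Icc (-(2 * R)) 0) by
      exact continuousOn_const.inner hc
    intro z hz
    by_cases hzs : S z ∈ tsupport G
    · have h1 : S ⁻¹' frameBox p b r R ∈ 𝓝 z :=
        hSc.continuousAt ((isOpen_frameBox p b r R).mem_nhds (hGs hzs))
      refine ContinuousWithinAt.mono_of_mem_nhdsWithin
        (t := (Icc (-r) r ×ˢ Icc (-(2 * R)) 0) ∩ S ⁻¹' frameBox p b r R) ?_
        (inter_mem_nhdsWithin _ h1)
      have hmaps : MapsTo S ((Icc (-r) r ×ˢ Icc (-(2 * R)) 0) ∩ S ⁻¹' frameBox p b r R)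
          (closure Ω) := fun y hy => by
        have h2 := (graphChart_mem_frameBox_iff p b g r R y).1 hy.2
        exact h.graphChart_mem_closure h2.1.le h2.2 hy.1.2.2
      exact (hGc.comp hSc.continuousOn hmaps) z ⟨hz, hGs hzs⟩
    · have h1 : G =ᶠ[𝓝 (S z)] 0 := notMem_tsupport_iff_eventuallyEq.1 hzs
      have h2 : (fun z => G (S z)) =ᶠ[𝓝 z] fun _ => 0 := hSc.continuousAt.eventually h1
      exact (continuousAt_const.congr h2.symm).continuousWithinAt
  have hBc : ContinuousOn B (Icc (-r) r ×ˢ Icc (-(2 * R)) 0) :=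
    (hAc 1).sub ((hdg'.continuous.comp continuous_fst).continuousOn.mul (hAc 0))
  have hu1 : uIcc (-r) r = Icc (-r) r := uIcc_of_le (by linarith)
  have hu2 : uIcc (-(2 * R)) 0 = Icc (-(2 * R)) 0 := uIcc_of_le (by linarith)
  have hQi' : IntegrableOn (fun z => fderiv ℝ (A 0) z (1, 0) + fderiv ℝ B z (0, 1)) Q :=
    hQi.congr_fun (fun z hz => (hdiv z hz).symm) hQm
  have key := integral2_divergence_prod_of_hasFDerivAt (A 0) B (fderiv ℝ (A 0)) (fderiv ℝ B)
    (-r) (-(2 * R)) r 0 (by rw [hu1, hu2]; exact hAc 0) (by rw [hu1, hu2]; exact hBc)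
    (fun z hz => by
      rw [min_eq_left (by linarith), max_eq_right (by linarith), min_eq_left (by linarith),
        max_eq_right (by linarith)] at hz
      exact (hAd 0 z hz).differentiableAt.hasFDerivAt)
    (fun z hz => by
      rw [min_eq_left (by linarith), max_eq_right (by linarith), min_eq_left (by linarith),
        max_eq_right (by linarith)] at hz
      exact (show HasFDerivAt B _ z from hBd z hz).differentiableAt.hasFDerivAt)
    (by rw [hu1, hu2]; exact hQi'.congr_set_ae hQe.symm)
  have hA_out : ∀ i z, ¬ (|z.1| < r ∧ |g z.1 + z.2| < R) → A i z = 0 := fun i z hz => by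
    simp only [hA]
    rw [hzero z fun hzs => hz (hbox z hzs), inner_zero_right]
  -- The lateral and bottom sides miss the support; only the top side `τ = 0`, which is the graph,
  -- contributes.
  have e1 : ∀ y, A 0 (r, y) = 0 := fun y => hA_out 0 _ fun hz => by
    have := hz.1
    simp only [abs_of_pos hr, lt_irrefl] at this
  have e2 : ∀ y, A 0 (-r, y) = 0 := fun y => hA_out 0 _ fun hz => by
    have := hz.1
    simp only [abs_neg, abs_of_pos hr, lt_irrefl] at this
  have e3 : ∀ i s, A i (s, -(2 * R)) = 0 := fun i s => hA_out i _ fun hz => by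
    have h3 := _root_.abs_lt.1 (hgR s hz.1.le)
    have h4 := _root_.abs_lt.1 hz.2
    simp only at h4
    linarith
  simp only [hB, e1, e2, e3, mul_zero, sub_zero, intervalIntegral.integral_zero, add_zero] at key
  rw [hint]
  calc ∫ z in Q, divergence G (S z)
      = ∫ z in Q, (fderiv ℝ (A 0) z (1, 0) + fderiv ℝ B z (0, 1)) :=
        setIntegral_congr_fun hQm fun z hz => (hdiv z hz).symm
    _ = ∫ z in Ioc (-r) r ×ˢ Ioc (-(2 * R)) 0,
          (fderiv ℝ (A 0) z (1, 0) + fderiv ℝ B z (0, 1)) := setIntegral_congr_set hQe'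
    _ = ∫ x in (-r)..r, ∫ y in (-(2 * R))..0,
          (fderiv ℝ (A 0) (x, y) (1, 0) + fderiv ℝ B (x, y) (0, 1)) := by
        rw [Measure.volume_eq_prod, setIntegral_prod _ (hQi'.congr_set_ae hQe'.symm),
          intervalIntegral.integral_of_le (by linarith)]
        simp only [intervalIntegral.integral_of_le (show -(2 * R) ≤ 0 by linarith)]
    _ = _ := by
        rw [hB, key]
        refine intervalIntegral.integral_congr fun s _ => ?_
        simp only [hA, inner_sub_left, inner_smul_left, RCLike.conj_to_real]

/-! ### Length of the boundary. -/

theorem IsLocalSubgraph.graph_mem_frontier {Ω : Set Plane} {p : Plane}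
    {b : OrthonormalBasis (Fin 2) ℝ Plane} {g : ℝ → ℝ} {r R δ : ℝ}
    (h : IsLocalSubgraph Ω p b g r R δ) (hΩ : IsOpen Ω) {s : ℝ} (hs : s ∈ Icc (-r) r) :
    graphChart p b g (s, 0) ∈ frontier Ω := by
  have h1 : |g s + 0| < R := by simpa using h.abs_lt s hs
  have hs' : |s| ≤ r := abs_le.2 hs
  refine ⟨h.graphChart_mem_closure hs' h1 le_rfl, ?_⟩
  rw [hΩ.interior_eq, h.graphChart_mem_iff hs' h1.le]
  exact lt_irrefl _

/-- Points below the graph are interior, and points above it have a neighbourhood missing `Ω`. -/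
theorem IsLocalSubgraph.frontier_inter_subset {Ω : Set Plane} {p : Plane}
    {b : OrthonormalBasis (Fin 2) ℝ Plane} {g : ℝ → ℝ} {r R δ : ℝ}
    (h : IsLocalSubgraph Ω p b g r R δ) (hΩ : IsOpen Ω) :
    frontier Ω ∩ frameBox p b r R ⊆ (fun s => graphChart p b g (s, 0)) '' Icc (-r) r := by
  rintro x ⟨hx, hxb⟩
  have hs : inner ℝ (b 0) (x - p) ∈ Icc (-r) r := abs_le.1 hxb.1.le
  have ht : inner ℝ (b 1) (x - p) ∈ Icc (-R) R := abs_le.1 hxb.2.le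
  refine ⟨inner ℝ (b 0) (x - p), hs, ?_⟩
  have h1 : ¬ inner ℝ (b 1) (x - p) < g (inner ℝ (b 0) (x - p)) := by
    rw [← h.mem_iff _ hs _ ht, frame_expansion, ← hΩ.interior_eq]
    exact hx.2
  have h2 : ¬ g (inner ℝ (b 0) (x - p)) < inner ℝ (b 1) (x - p) := fun hlt => by
    have hgc := h.contDiff.continuous
    have ho : IsOpen (frameBox p b r R ∩
        {y | g (inner ℝ (b 0) (y - p)) < inner ℝ (b 1) (y - p)}) :=
      (isOpen_frameBox p b r R).inter (isOpen_lt (by fun_prop) (by fun_prop))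
    obtain ⟨y, hy, hyΩ⟩ := mem_closure_iff.1 hx.1 _ ho ⟨hxb, hlt⟩
    have h3 := (h.mem_iff (inner ℝ (b 0) (y - p)) (abs_le.1 hy.1.1.le)
      (inner ℝ (b 1) (y - p)) (abs_le.1 hy.1.2.le)).1 (by rwa [frame_expansion])
    exact lt_asymm h3 hy.2
  have h3 : g (inner ℝ (b 0) (x - p)) = inner ℝ (b 1) (x - p) :=
    le_antisymm (not_lt.1 h1) (not_lt.1 h2)
  change p + inner ℝ (b 0) (x - p) • b 0 + (g (inner ℝ (b 0) (x - p)) + 0) • b 1 = x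
  rw [add_zero, h3, frame_expansion]

/-- The graph parameter is dominated by arc length, as the projection to the axis is
`1`-Lipschitz. -/
theorem IsLocalSubgraph.lintegral_graph_le {Ω : Set Plane} {p : Plane}
    {b : OrthonormalBasis (Fin 2) ℝ Plane} {g : ℝ → ℝ} {r R δ : ℝ}
    (h : IsLocalSubgraph Ω p b g r R δ) (hΩ : IsOpen Ω) {φ : Plane → ENNReal}
    (hφ : Measurable φ) :
    ∫⁻ s in Icc (-r) r, φ (graphChart p b g (s, 0)) ≤
      ∫⁻ x in frontier Ω, φ x ∂(Measure.hausdorffMeasure 1) := by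
  set γ : ℝ → Plane := fun s => graphChart p b g (s, 0) with hγ
  have hγc : Continuous γ :=
    (continuous_graphChart p b h.contDiff.continuous).comp (by fun_prop)
  set π : Plane → ℝ := fun x => inner ℝ (b 0) (x - p) with hπ
  have hπγ : ∀ s, π (γ s) = s := fun s => inner_zero_frame p b _ _
  have hπm : Measurable π := by
    have : Continuous π := by fun_prop
    exact this.measurable
  have hπl : LipschitzWith 1 π := LipschitzWith.of_dist_le_mul fun x y => by
    rw [Real.dist_eq, hπ]
    simp only
    rw [← inner_sub_right, sub_sub_sub_cancel_right, dist_eq_norm]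
    simpa using abs_real_inner_le_norm (b 0) (x - y)
  have hK : MeasurableSet (γ '' Icc (-r) r) := (isCompact_Icc.image hγc).isClosed.measurableSet
  set μ := (Measure.hausdorffMeasure 1 : Measure Plane).restrict (γ '' Icc (-r) r) with hμ
  -- Each part of the interval is the projection of the piece of graph over it, and a `1`-Lipschitz
  -- map does not increase `H¹`, which is Lebesgue measure on the line.
  have hle : volume.restrict (Icc (-r) r) ≤ μ.map π := by
    refine Measure.le_iff.2 fun B hB => ?_
    rw [Measure.map_apply hπm hB, hμ, Measure.restrict_apply (hπm hB), Measure.restrict_apply hB,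
      ← hausdorffMeasure_real]
    have h1 : B ∩ Icc (-r) r ⊆ π '' (π ⁻¹' B ∩ γ '' Icc (-r) r) := fun s hs =>
      ⟨γ s, ⟨by rw [mem_preimage, hπγ]; exact hs.1, mem_image_of_mem _ hs.2⟩, hπγ s⟩
    calc _ ≤ _ := measure_mono h1
      _ ≤ _ := hπl.hausdorffMeasure_image_le zero_le_one _
      _ = _ := by simp
  calc ∫⁻ s in Icc (-r) r, φ (γ s) ≤ ∫⁻ s, φ (γ s) ∂(μ.map π) := lintegral_mono' hle le_rfl
    _ = ∫⁻ x, φ (γ (π x)) ∂μ := lintegral_map (hφ.comp hγc.measurable) hπm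
    _ = ∫⁻ x, φ x ∂μ := by
      refine setLIntegral_congr_fun hK fun x hx => ?_
      obtain ⟨s, -, rfl⟩ := hx
      simp only [hπγ]
    _ ≤ _ := lintegral_mono_set (image_subset_iff.2 fun s hs => h.graph_mem_frontier hΩ hs)

/-- The boundary piece lies in a Lipschitz image of a compact interval. -/
theorem IsLocalSubgraph.hausdorffMeasure_frontier_inter_lt_top {Ω : Set Plane} {p : Plane}
    {b : OrthonormalBasis (Fin 2) ℝ Plane} {g : ℝ → ℝ} {r R δ : ℝ}
    (h : IsLocalSubgraph Ω p b g r R δ) (hΩ : IsOpen Ω) :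
    Measure.hausdorffMeasure 1 (frontier Ω ∩ frameBox p b r R) < ⊤ := by
  have hγ : ContDiff ℝ 1 fun s => graphChart p b g (s, 0) := by
    have := h.contDiff.of_le (m := 1) (by norm_num)
    unfold graphChart
    fun_prop
  obtain ⟨K, hK⟩ := hγ.locallyLipschitz.locallyLipschitzOn.exists_lipschitzOnWith_of_compact
    (isCompact_Icc (a := -r) (b := r))
  calc _ ≤ _ := measure_mono (h.frontier_inter_subset hΩ)
    _ ≤ _ := hK.hausdorffMeasure_image_le zero_le_one
    _ < ⊤ := by
      rw [hausdorffMeasure_real, Real.volume_Icc]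
      exact ENNReal.mul_lt_top (by simp) ENNReal.ofReal_lt_top

theorem HasSmoothBoundary.exists_isLocalSubgraph {Ω : Set Plane} (h : HasSmoothBoundary Ω)
    {p : Plane} (hp : p ∈ frontier Ω) {δ : ℝ} (hδ : 0 < δ) :
    ∃ b g r R, IsLocalSubgraph Ω p b g r R δ := by
  obtain ⟨U, ρ, hU, hpU, hρ, hρp, hdρ, hΩU⟩ := h p hp
  exact _root_.exists_isLocalSubgraph hU hpU hρ hρp hdρ hΩU hδ

theorem hausdorffMeasure_frontier_lt_top {Ω : Set Plane} (hΩ : IsOpen Ω)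
    (hc : IsCompact (closure Ω)) (h : HasSmoothBoundary Ω) :
    Measure.hausdorffMeasure 1 (frontier Ω) < ⊤ := by
  refine (hc.of_isClosed_subset isClosed_frontier frontier_subset_closure
    ).measure_lt_top_of_nhdsWithin fun p hp => ?_
  obtain ⟨b, g, r, R, hl⟩ := h.exists_isLocalSubgraph hp one_pos
  exact ⟨frontier Ω ∩ frameBox p b r R, inter_mem_nhdsWithin _
    ((isOpen_frameBox p b r R).mem_nhds (mem_frameBox_self p b hl.r_pos hl.R_pos)),
    hl.hausdorffMeasure_frontier_inter_lt_top hΩ⟩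

/-- Finite `H¹` forces `H²` to vanish, and area is a multiple of `H²`. This makes the areas of `Ω`
and its closure agree. -/
theorem volume_eq_zero_of_hausdorffMeasure_one_lt_top {s : Set Plane}
    (h : Measure.hausdorffMeasure 1 s < ⊤) : volume s = 0 := by
  have h2 : Measure.hausdorffMeasure ((2 : ℕ) : ℝ) s = 0 :=
    (Measure.hausdorffMeasure_zero_or_top (by norm_num) s).resolve_right h.ne
  rw [← EuclideanSpace.euclideanHausdorffMeasure_eq_volume,
    Measure.euclideanHausdorffMeasure_def, Measure.smul_apply, h2, smul_zero]

/-! ### Derivatives up to the boundary. -/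

/-- At a boundary point the tangent cone contains the open half-plane `dρ < 0`, which spans.
One-sided derivatives are therefore unique, and those of `C¹` functions are continuous up to the
boundary. -/
theorem HasSmoothBoundary.uniqueDiffOn_closure {Ω : Set Plane} (hΩ : IsOpen Ω)
    (h : HasSmoothBoundary Ω) : UniqueDiffOn ℝ (closure Ω) := by
  intro p hp
  by_cases hpΩ : p ∈ Ω
  · exact (hΩ.uniqueDiffWithinAt hpΩ).mono subset_closure
  obtain ⟨U, ρ, hU, hpU, hρ, hρp, hdρ, hΩU⟩ := h p ⟨hp, by rwa [hΩ.interior_eq]⟩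
  have hd : HasFDerivAt ρ (fderiv ℝ ρ p) p :=
    ((hρ.contDiffAt (hU.mem_nhds hpU)).differentiableAt (by simp)).hasFDerivAt
  have hcone : {v | fderiv ℝ ρ p v < 0} ⊆ tangentConeAt ℝ (closure Ω) p := by
    intro v hv
    have hl : HasDerivAt (fun t : ℝ => ρ (p + t • v)) (fderiv ℝ ρ p v) 0 := by
      have h1 : HasDerivAt (fun t : ℝ => p + t • v) v 0 := by
        simpa using ((hasDerivAt_id (0 : ℝ)).smul_const v).const_add p
      exact HasFDerivAt.comp_hasDerivAt (0 : ℝ) (by simpa using hd) h1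
    have h2 : ∀ᶠ t in 𝓝[>] (0 : ℝ), ρ (p + t • v) < 0 := by
      have h3 := hl.hasDerivWithinAt (s := Ioi 0)
      have h4 := (hasDerivWithinAt_iff_tendsto_slope' (by simp)).1 h3
      filter_upwards [h4.eventually_lt_const hv, self_mem_nhdsWithin] with t h5 h6
      rw [slope_def_field] at h5
      simp only [zero_smul, add_zero, hρp, sub_zero] at h5
      by_contra! h7
      exact absurd (div_nonneg h7 (le_of_lt h6)) (not_le.2 h5)
    have h3 : ∀ᶠ t in 𝓝[>] (0 : ℝ), p + t • v ∈ U := by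
      have : Continuous fun t : ℝ => p + t • v := by fun_prop
      exact nhdsWithin_le_nhds (this.continuousAt.eventually_mem (hU.mem_nhds (by simpa)))
    refine mem_tangentConeAt_of_add_smul_mem (l := 𝓝[>] (0 : ℝ)) (c := id)
      (tendsto_id'.2 (nhdsGT_le_nhdsNE 0)) ?_
    filter_upwards [h2, h3] with t h4 h5
    have h6 : p + t • v ∈ Ω ∩ U := by rw [hΩU]; exact ⟨h5, h4⟩
    exact subset_closure h6.1
  refine ⟨?_, subset_closure hp⟩
  have htop : Submodule.span ℝ (tangentConeAt ℝ (closure Ω) p) = ⊤ := by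
    refine Submodule.eq_top_of_nonempty_interior' _ ?_
    have ho : IsOpen {v | fderiv ℝ ρ p v < 0} := isOpen_lt (by fun_prop) continuous_const
    have hne : {v | fderiv ℝ ρ p v < 0}.Nonempty := by
      obtain ⟨v, hv⟩ : ∃ v, fderiv ℝ ρ p v ≠ 0 := by
        by_contra! hh
        exact hdρ (ContinuousLinearMap.ext hh)
      rcases lt_or_gt_of_ne hv with hv | hv
      · exact ⟨v, hv⟩
      · exact ⟨-v, by simpa using hv⟩
    exact hne.mono (interior_maximal (hcone.trans Submodule.subset_span) ho)
  rw [htop]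
  exact dense_univ

/-- In `Ω` the divergence agrees with the one built from `fderivWithin`, which is continuous on the
compact closure. -/
theorem integrableOn_divergence {Ω : Set Plane} (hΩ : IsOpen Ω) (hc : IsCompact (closure Ω))
    (hu : UniqueDiffOn ℝ (closure Ω)) {G : Plane → Plane} (hG : ContDiffOn ℝ 1 G (closure Ω)) :
    IntegrableOn (divergence G) Ω := by
  have h1 : ContinuousOn (fderivWithin ℝ G (closure Ω)) (closure Ω) :=
    hG.continuousOn_fderivWithin hu le_rfl
  set b := EuclideanSpace.basisFun (Fin 2) ℝ
  have h2 : ContinuousOn (fun x => inner ℝ (b 0) (fderivWithin ℝ G (closure Ω) x (b 0)) +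
      inner ℝ (b 1) (fderivWithin ℝ G (closure Ω) x (b 1))) (closure Ω) :=
    (continuousOn_const.inner (h1.clm_apply continuousOn_const)).add
      (continuousOn_const.inner (h1.clm_apply continuousOn_const))
  refine ((h2.integrableOn_compact hc).mono_set subset_closure).congr_fun (fun x hx => ?_)
    hΩ.measurableSet
  simp only [divergence_eq_sum_inner b,
    fderivWithin_of_mem_nhds (mem_of_superset (hΩ.mem_nhds hx) subset_closure)]

/-! ### The flux inequality. -/

theorem integrableOn_hausdorffMeasure_of_continuous {K : Set Plane} (hK : IsCompact K)
    (hfin : Measure.hausdorffMeasure 1 K < ⊤) {φ : Plane → ℝ} (hφ : Continuous φ) :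
    IntegrableOn φ K (Measure.hausdorffMeasure 1) := by
  obtain ⟨C, hC⟩ := hK.exists_bound_of_continuousOn hφ.continuousOn
  exact IntegrableOn.of_bound hfin hφ.aestronglyMeasurable C
    (ae_restrict_of_forall_mem hK.measurableSet hC)

theorem tsupport_smul_subset_tsupport_left (φ : Plane → ℝ) (F : Plane → Plane) :
    tsupport (fun x => φ x • F x) ⊆ tsupport φ :=
  closure_mono fun x hx h => hx (by simp [h])

/-- The contribution of a boundary rectangle to the divergence theorem. -/
theorem IsLocalSubgraph.abs_setIntegral_divergence_smul_le {Ω : Set Plane} {p : Plane}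
    {b : OrthonormalBasis (Fin 2) ℝ Plane} {g : ℝ → ℝ} {r R δ : ℝ}
    (h : IsLocalSubgraph Ω p b g r R δ) (hΩ : IsOpen Ω) (hc : IsCompact (closure Ω))
    (hu : UniqueDiffOn ℝ (closure Ω)) (hfin : Measure.hausdorffMeasure 1 (frontier Ω) < ⊤)
    {F : Plane → Plane} (hF : ContDiffOn ℝ 1 F (closure Ω)) {M : ℝ}
    (hM : ∀ x ∈ frontier Ω, ‖F x‖ ≤ M) {φ : Plane → ℝ} (hφ : ContDiff ℝ 1 φ)
    (hφ0 : ∀ x, 0 ≤ φ x) (hφs : tsupport φ ⊆ frameBox p b r R) :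
    |∫ x in Ω, divergence (fun x => φ x • F x) x| ≤
      M * (1 + δ) * ∫ x in frontier Ω, φ x ∂(Measure.hausdorffMeasure 1) := by
  have hr : -r ≤ r := by linarith [h.r_pos]
  have hG : ContDiffOn ℝ 1 (fun x => φ x • F x) (closure Ω) := hφ.contDiffOn.smul hF
  rw [h.setIntegral_divergence hΩ hG.continuousOn
    ((hG.differentiableOn (by simp)).mono subset_closure)
    ((tsupport_smul_subset_tsupport_left φ F).trans hφs) (integrableOn_divergence hΩ hc hu hG)]
  set γ : ℝ → Plane := fun s => graphChart p b g (s, 0) with hγ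
  have hγc : Continuous γ :=
    (continuous_graphChart p b h.contDiff.continuous).comp (by fun_prop)
  have hγf : ∀ s ∈ Icc (-r) r, γ s ∈ frontier Ω := fun s hs => h.graph_mem_frontier hΩ hs
  have hM0 : 0 ≤ M := (norm_nonneg _).trans (hM _ (hγf r ⟨hr, le_rfl⟩))
  have hδ0 : 0 ≤ δ := (abs_nonneg _).trans (h.abs_deriv_le r ⟨hr, le_rfl⟩)
  have hφγ : Continuous fun s => φ (γ s) := hφ.continuous.comp hγc
  have h1 : ‖∫ s in (-r)..r, inner ℝ (b 1 - deriv g s • b 0) (φ (γ s) • F (γ s))‖ ≤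
      ∫ s in (-r)..r, M * (1 + δ) * φ (γ s) := by
    refine intervalIntegral.norm_integral_le_of_norm_le hr (Eventually.of_forall fun s hs => ?_)
      ((continuous_const.mul hφγ).intervalIntegrable _ _)
    have hs' := Ioc_subset_Icc_self hs
    have h2 : ‖b 1 - deriv g s • b 0‖ ≤ 1 + δ := by
      refine (norm_sub_le _ _).trans ?_
      rw [norm_smul, b.norm_eq_one, b.norm_eq_one, mul_one, Real.norm_eq_abs]
      linarith [h.abs_deriv_le s hs']
    calc ‖inner ℝ (b 1 - deriv g s • b 0) (φ (γ s) • F (γ s))‖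
        ≤ ‖b 1 - deriv g s • b 0‖ * ‖φ (γ s) • F (γ s)‖ := norm_inner_le_norm _ _
      _ ≤ (1 + δ) * (φ (γ s) * M) := by
        rw [norm_smul, Real.norm_of_nonneg (hφ0 _)]
        exact mul_le_mul h2 (mul_le_mul_of_nonneg_left (hM _ (hγf s hs')) (hφ0 _))
          (mul_nonneg (hφ0 _) (norm_nonneg _)) (by linarith)
      _ = _ := by ring
  refine h1.trans ?_
  rw [intervalIntegral.integral_const_mul]
  refine mul_le_mul_of_nonneg_left ?_ (mul_nonneg hM0 (by linarith))
  rw [intervalIntegral.integral_of_le hr, ← integral_Icc_eq_integral_Ioc,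
    integral_eq_lintegral_of_nonneg_ae (Eventually.of_forall fun s => hφ0 _)
      hφγ.aestronglyMeasurable,
    integral_eq_lintegral_of_nonneg_ae (Eventually.of_forall fun s => hφ0 _)
      hφ.continuous.aestronglyMeasurable]
  -- The boundary integral must be finite, since `toReal` sends `⊤` to `0`.
  refine ENNReal.toReal_mono ?_
    (h.lintegral_graph_le hΩ (φ := fun x => ENNReal.ofReal (φ x))
      hφ.continuous.measurable.ennreal_ofReal)
  have hi := integrableOn_hausdorffMeasure_of_continuous
    (hc.of_isClosed_subset isClosed_frontier frontier_subset_closure) hfin hφ.continuous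
  have hi' := hi.hasFiniteIntegral
  rw [hasFiniteIntegral_iff_ofReal (Eventually.of_forall hφ0)] at hi'
  exact hi'.ne

theorem integral_divergence_eq_zero {G : Plane → Plane} (hG : ContDiff ℝ 1 G)
    (hs : HasCompactSupport G) : ∫ x, divergence G x = 0 := by
  set b := EuclideanSpace.basisFun (Fin 2) ℝ
  have hd := hG.differentiable (by simp)
  have hcont : ∀ i, Continuous fun x => fderiv ℝ G x (b i) := fun i =>
    (hG.continuous_fderiv (by simp)).clm_apply continuous_const
  have hcs : ∀ i, HasCompactSupport fun x => fderiv ℝ G x (b i) := fun i => hs.fderiv_apply ℝ (b i)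
  have hint : ∀ i, Integrable fun x => fderiv ℝ G x (b i) := fun i =>
    (hcont i).integrable_of_hasCompactSupport (hcs i)
  have h0 : ∀ i, ∫ x, fderiv ℝ G x (b i) = 0 := fun i => by
    -- Integration by parts against the constant `1`.
    have h := integral_bilinear_fderiv_right_eq_neg_left_of_integrable (μ := volume)
      (f := fun _ : Plane => (1 : ℝ)) (g := G) (v := b i)
      (B := ContinuousLinearMap.lsmul ℝ ℝ)
      (by simp) (by simpa using hint i)
      (by simpa using hG.continuous.integrable_of_hasCompactSupport hs)
      (fun x _ => by fun_prop) (fun x _ => hd x)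
    simpa using h
  simp only [divergence_eq_sum_inner b]
  rw [integral_add ((hint 0).const_inner _) ((hint 1).const_inner _),
    integral_inner (hint 0), integral_inner (hint 1), h0, h0]
  simp

/-- The cut-off field vanishes near every point outside `Ω`, so it is `C¹` and compactly supported
on the whole plane. -/
theorem setIntegral_divergence_smul_eq_zero {Ω : Set Plane} (hΩ : IsOpen Ω)
    (hc : IsCompact (closure Ω)) {F : Plane → Plane} (hF : ContDiffOn ℝ 1 F (closure Ω))
    {φ : Plane → ℝ} (hφ : ContDiff ℝ 1 φ) (hφs : tsupport φ ⊆ Ω) :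
    ∫ x in Ω, divergence (fun x => φ x • F x) x = 0 := by
  have hsub := tsupport_smul_subset_tsupport_left φ F
  rw [setIntegral_eq_integral_of_forall_compl_eq_zero fun x hx =>
    divergence_of_notMem_tsupport fun hx' => hx (hφs (hsub hx'))]
  refine integral_divergence_eq_zero (contDiff_iff_contDiffAt.2 fun x => ?_)
    (hc.of_isClosed_subset (isClosed_tsupport _) ((hsub.trans hφs).trans subset_closure))
  by_cases hx : x ∈ tsupport fun x => φ x • F x
  · exact hφ.contDiffAt.smul (hF.contDiffAt
      (mem_of_superset (hΩ.mem_nhds (hφs (hsub hx))) subset_closure))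
  · exact contDiffAt_const.congr_of_eventuallyEq (notMem_tsupport_iff_eventuallyEq.1 hx)

/-- The flux inequality: the integral of the divergence of a field bounded by `M` on the boundary
is at most `M` times the length of the boundary. -/
theorem abs_setIntegral_divergence_le {Ω : Set Plane} (hΩ : IsOpen Ω)
    (hc : IsCompact (closure Ω)) (hs : HasSmoothBoundary Ω) {F : Plane → Plane}
    (hF : ContDiffOn ℝ 1 F (closure Ω)) {M : ℝ} (hM0 : 0 ≤ M)
    (hM : ∀ x ∈ frontier Ω, ‖F x‖ ≤ M) :
    |∫ x in Ω, divergence F x| ≤ M * (Measure.hausdorffMeasure 1).real (frontier Ω) := by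
  have hu := hs.uniqueDiffOn_closure hΩ
  have hfin := hausdorffMeasure_frontier_lt_top hΩ hc hs
  have hfc : IsCompact (frontier Ω) :=
    hc.of_isClosed_subset isClosed_frontier frontier_subset_closure
  set L := (Measure.hausdorffMeasure 1).real (frontier Ω) with hL
  have hL0 : 0 ≤ L := measureReal_nonneg
  suffices key : ∀ δ > 0, |∫ x in Ω, divergence F x| ≤ M * (1 + δ) * L by
    refine le_of_forall_pos_le_add fun ε hε => ?_
    have hML : 0 ≤ M * L := mul_nonneg hM0 hL0
    -- The `+ 1` keeps the denominator positive when `M * L = 0`.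
    refine (key (ε / (M * L + 1)) (by positivity)).trans ?_
    have h1 : ε / (M * L + 1) * (M * L) ≤ ε := by
      rw [div_mul_eq_mul_div, div_le_iff₀ (by positivity)]
      nlinarith
    linarith
  intro δ hδ
  have hloc : ∀ p : frontier Ω, ∃ b g r R, IsLocalSubgraph Ω (p : Plane) b g r R δ := fun p =>
    hs.exists_isLocalSubgraph p.2 hδ
  choose b g r R hl using hloc
  obtain ⟨t, ht⟩ := hfc.elim_finite_subcover (fun p : frontier Ω => frameBox p (b p) (r p) (R p))
    (fun p => isOpen_frameBox _ _ _ _)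
    (fun x hx => mem_iUnion.2 ⟨⟨x, hx⟩, mem_frameBox_self _ _ (hl _).r_pos (hl _).R_pos⟩)
  -- `none` indexes the interior piece, `some p` the boundary rectangles.
  let U : Option t → Set Plane := fun i =>
    i.elim Ω fun p => frameBox (p : frontier Ω) (b p) (r p) (R p)
  have hUo : ∀ i, IsOpen (U i) := fun i => by
    cases i with
    | none => exact hΩ
    | some p => exact isOpen_frameBox _ _ _ _
  have hUc : closure Ω ⊆ ⋃ i, U i := fun x hx => by
    by_cases hxΩ : x ∈ Ω
    · exact mem_iUnion.2 ⟨none, hxΩ⟩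
    · obtain ⟨p, hp, hxp⟩ := mem_iUnion₂.1 (ht ⟨hx, by rwa [hΩ.interior_eq]⟩)
      exact mem_iUnion.2 ⟨some ⟨p, hp⟩, hxp⟩
  obtain ⟨f, hf⟩ := SmoothPartitionOfUnity.exists_isSubordinate (modelWithCornersSelf ℝ Plane)
    isClosed_closure U hUo hUc
  have hfs : ∀ i, ContDiff ℝ 1 (f i) := fun i =>
    ((f i).contMDiff.contDiff).of_le
      (WithTop.coe_le_coe.2 le_top : ((1 : ℕ∞) : WithTop ℕ∞) ≤ ((⊤ : ℕ∞) : WithTop ℕ∞))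
  have hsum : ∀ x ∈ closure Ω, ∑ i, f i x = 1 := fun x hx => by
    rw [← finsum_eq_sum_of_fintype]
    exact f.sum_eq_one hx
  have hG : ∀ i, ContDiffOn ℝ 1 (fun x => f i x • F x) (closure Ω) := fun i =>
    (hfs i).contDiffOn.smul hF
  have hdiv : ∀ x ∈ Ω, divergence F x = ∑ i, divergence (fun x => f i x • F x) x := by
    intro x hx
    have hnhds : closure Ω ∈ 𝓝 x := mem_of_superset (hΩ.mem_nhds hx) subset_closure
    have he : F =ᶠ[𝓝 x] fun y => ∑ i, f i y • F y := by
      filter_upwards [hnhds] with y hy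
      rw [← Finset.sum_smul, hsum y hy, one_smul]
    simp only [divergence]
    rw [he.fderiv_eq, fderiv_fun_sum fun i _ =>
      ((hG i).contDiffAt hnhds).differentiableAt (by simp), ← map_sum]
    congr 1
    ext v
    simp
  have hbound : ∀ i, |∫ x in Ω, divergence (fun x => f i x • F x) x| ≤
      M * (1 + δ) * ∫ x in frontier Ω, f i x ∂(Measure.hausdorffMeasure 1) := fun i => by
    cases i with
    | none =>
      rw [setIntegral_divergence_smul_eq_zero hΩ hc hF (hfs none) (hf none), abs_zero]
      exact mul_nonneg (mul_nonneg hM0 (by linarith)) (integral_nonneg fun x => f.nonneg _ x)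
    | some p =>
      exact (hl p).abs_setIntegral_divergence_smul_le hΩ hc hu hfin hF hM (hfs _)
        (fun x => f.nonneg _ x) (hf (some p))
  calc |∫ x in Ω, divergence F x|
      = |∑ i, ∫ x in Ω, divergence (fun x => f i x • F x) x| := by
        rw [setIntegral_congr_fun hΩ.measurableSet hdiv,
          integral_finsetSum _ fun i _ => integrableOn_divergence hΩ hc hu (hG i)]
    _ ≤ ∑ i, M * (1 + δ) * ∫ x in frontier Ω, f i x ∂(Measure.hausdorffMeasure 1) :=
        (Finset.abs_sum_le_sum_abs _ _).trans (Finset.sum_le_sum fun i _ => hbound i)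
    _ = M * (1 + δ) * ∫ x in frontier Ω, ∑ i, f i x ∂(Measure.hausdorffMeasure 1) := by
        rw [← Finset.mul_sum, integral_finsetSum _ fun i _ =>
          integrableOn_hausdorffMeasure_of_continuous hfc hfin (hfs i).continuous]
    _ = M * (1 + δ) * L := by
        rw [setIntegral_congr_fun hfc.measurableSet fun x hx =>
          hsum x (frontier_subset_closure hx)]
        simp [hL]

/-! ### Mean curvature and gradient of a graph. -/

theorem fderivWithin_euclidean_apply {n : ℕ} {Y : Plane → EuclideanSpace ℝ (Fin n)} {S : Set Plane}
    {x : Plane} (hY : DifferentiableWithinAt ℝ Y S x) (hu : UniqueDiffWithinAt ℝ S x) (v : Plane)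
    (k : Fin n) : fderivWithin ℝ Y S x v k = fderivWithin ℝ (fun y => Y y k) S x v := by
  have h := (EuclideanSpace.proj (𝕜 := ℝ) k).hasFDerivAt.comp_hasFDerivWithinAt x
    hY.hasFDerivWithinAt
  have h2 : fderivWithin ℝ (fun y => Y y k) S x = _ := h.fderivWithin hu
  rw [h2]
  rfl

/-- The partial derivative of a scalar function, taken within `S`. -/
noncomputable def scalarPartial (S : Set Plane) (i : Fin 2) (f : Plane → ℝ) (x : Plane) : ℝ :=
  fderivWithin ℝ f S x (EuclideanSpace.single i 1)

theorem contDiffOn_scalarPartial {S : Set Plane} (hu : UniqueDiffOn ℝ S) {f : Plane → ℝ}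
    {m n : WithTop ℕ∞} (hf : ContDiffOn ℝ n f S) (hmn : m + 1 ≤ n) (i : Fin 2) :
    ContDiffOn ℝ m (scalarPartial S i f) S :=
  (hf.fderivWithin hu hmn).clm_apply contDiffOn_const

theorem contDiffOn_graphMap {S : Set Plane} {Ψ : Plane → ℝ} {n : WithTop ℕ∞}
    (hΨ : ContDiffOn ℝ n Ψ S) : ContDiffOn ℝ n (graphMap Ψ) S := by
  refine contDiffOn_euclidean.2 fun k => ?_
  fin_cases k
  · exact (EuclideanSpace.proj (𝕜 := ℝ) (0 : Fin 2)).contDiff.contDiffOn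
  · exact (EuclideanSpace.proj (𝕜 := ℝ) (1 : Fin 2)).contDiff.contDiffOn
  · exact hΨ

theorem fderivWithin_coord {S : Set Plane} {x : Plane} (hu : UniqueDiffWithinAt ℝ S x)
    (k : Fin 2) (v : Plane) : fderivWithin ℝ (fun y : Plane => y k) S x v = v k := by
  have h := (EuclideanSpace.proj (𝕜 := ℝ) k).hasFDerivWithinAt (x := x) (s := S)
  have h2 : fderivWithin ℝ (fun y : Plane => y k) S x = _ := h.fderivWithin hu
  rw [h2]
  rfl

theorem fderivWithin_graphMap {S : Set Plane} (hu : UniqueDiffOn ℝ S) {Ψ : Plane → ℝ}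
    (hΨ : ContDiffOn ℝ 1 Ψ S) {x : Plane} (hx : x ∈ S) (v : Plane) :
    fderivWithin ℝ (graphMap Ψ) S x v = !₂[v 0, v 1, fderivWithin ℝ Ψ S x v] := by
  have hd := ((contDiffOn_graphMap hΨ).differentiableOn (by simp)) x hx
  ext k
  rw [fderivWithin_euclidean_apply hd (hu x hx)]
  fin_cases k
  · exact fderivWithin_coord (hu x hx) 0 v
  · exact fderivWithin_coord (hu x hx) 1 v
  · rfl

theorem partialWithin_graphMap {S : Set Plane} (hu : UniqueDiffOn ℝ S) {Ψ : Plane → ℝ}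
    (hΨ : ContDiffOn ℝ 1 Ψ S) {x : Plane} (hx : x ∈ S) (i : Fin 2) :
    partialWithin S i (graphMap Ψ) x =
      !₂[EuclideanSpace.single i (1 : ℝ) 0, EuclideanSpace.single i (1 : ℝ) 1,
        scalarPartial S i Ψ x] :=
  fderivWithin_graphMap hu hΨ hx _

theorem partialWithin_partialWithin_graphMap {S : Set Plane} (hu : UniqueDiffOn ℝ S)
    {Ψ : Plane → ℝ} (hΨ : ContDiffOn ℝ 2 Ψ S) {x : Plane} (hx : x ∈ S) (i j : Fin 2) :
    partialWithin S j (partialWithin S i (graphMap Ψ)) x =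
      !₂[0, 0, scalarPartial S j (scalarPartial S i Ψ) x] := by
  have hΨ1 : ContDiffOn ℝ 1 Ψ S := hΨ.of_le (by norm_num)
  have hc : ∀ y ∈ S, ∀ k, partialWithin S i (graphMap Ψ) y k =
      (!₂[EuclideanSpace.single i (1 : ℝ) 0, EuclideanSpace.single i (1 : ℝ) 1,
        scalarPartial S i Ψ y] : EuclideanSpace ℝ (Fin 3)) k := fun y hy k => by
    rw [partialWithin_graphMap hu hΨ1 hy]
  have hd : DifferentiableWithinAt ℝ (partialWithin S i (graphMap Ψ)) S x :=
    (((contDiffOn_graphMap hΨ).fderivWithin hu (m := 1) (by norm_num)).clm_apply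
      contDiffOn_const).differentiableOn (by simp) x hx
  ext k
  rw [partialWithin, fderivWithin_euclidean_apply hd (hu x hx),
    fderivWithin_congr (fun y hy => hc y hy k) (hc x hx k)]
  fin_cases k
  · simp
  · simp
  · rfl

/-- The mean curvature of a graph in terms of the partial derivatives of its height function. -/
theorem meanCurvature_graphMap {S : Set Plane} (hu : UniqueDiffOn ℝ S) {Ψ : Plane → ℝ}
    (hΨ : ContDiffOn ℝ 2 Ψ S) {x : Plane} (hx : x ∈ S) :
    meanCurvature (graphMap Ψ) S x =
      (√(1 - scalarPartial S 0 Ψ x ^ 2 - scalarPartial S 1 Ψ x ^ 2))⁻¹ *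
        (scalarPartial S 0 (scalarPartial S 0 Ψ) x * (1 - scalarPartial S 1 Ψ x ^ 2) +
          2 * (scalarPartial S 0 Ψ x * scalarPartial S 1 Ψ x) *
            scalarPartial S 1 (scalarPartial S 0 Ψ) x +
          scalarPartial S 1 (scalarPartial S 1 Ψ) x * (1 - scalarPartial S 0 Ψ x ^ 2)) /
        (2 * (1 - scalarPartial S 0 Ψ x ^ 2 - scalarPartial S 1 Ψ x ^ 2)) := by
  have hΨ1 : ContDiffOn ℝ 1 Ψ S := hΨ.of_le (by norm_num)
  simp only [meanCurvature, secondForm, firstForm, unitNormal, lorentzInner, lorentzCross,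
    partialWithin_partialWithin_graphMap hu hΨ hx, partialWithin_graphMap hu hΨ1 hx]
  simp
  ring_nf

theorem continuousOn_meanCurvature_graphMap {S : Set Plane} (hu : UniqueDiffOn ℝ S)
    {Ψ : Plane → ℝ} (hΨ : ContDiffOn ℝ 2 Ψ S)
    (hw : ∀ x ∈ S, 0 < 1 - scalarPartial S 0 Ψ x ^ 2 - scalarPartial S 1 Ψ x ^ 2) :
    ContinuousOn (meanCurvature (graphMap Ψ) S) S := by
  have h1 : ∀ i, ContDiffOn ℝ 1 (scalarPartial S i Ψ) S := fun i =>
    contDiffOn_scalarPartial hu hΨ (by norm_num) i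
  have hp : ∀ i, ContinuousOn (scalarPartial S i Ψ) S := fun i => (h1 i).continuousOn
  have hh : ∀ i j, ContinuousOn (scalarPartial S j (scalarPartial S i Ψ)) S := fun i j =>
    (contDiffOn_scalarPartial hu (h1 i) (m := 0) (by norm_num) j).continuousOn
  have hwc : ContinuousOn
      (fun x => 1 - scalarPartial S 0 Ψ x ^ 2 - scalarPartial S 1 Ψ x ^ 2) S :=
    (continuousOn_const.sub ((hp 0).pow 2)).sub ((hp 1).pow 2)
  refine ContinuousOn.congr ?_ fun x hx => meanCurvature_graphMap hu hΨ hx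
  refine ContinuousOn.div ((hwc.sqrt.inv₀ fun x hx => (Real.sqrt_pos.2 (hw x hx)).ne').mul ?_)
    (continuousOn_const.mul hwc) fun x hx => (mul_pos two_pos (hw x hx)).ne'
  exact (((hh 0 0).mul (continuousOn_const.sub ((hp 1).pow 2))).add
    ((continuousOn_const.mul ((hp 0).mul (hp 1))).mul (hh 0 1))).add
    ((hh 1 1).mul (continuousOn_const.sub ((hp 0).pow 2)))

theorem gradientWithin_eq (S : Set Plane) (Ψ : Plane → ℝ) (x : Plane) :
    gradientWithin Ψ S x = !₂[scalarPartial S 0 Ψ x, scalarPartial S 1 Ψ x] := by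
  have h : ∀ i, gradientWithin Ψ S x i = scalarPartial S i Ψ x := fun i => by
    have h1 : inner ℝ (gradientWithin Ψ S x) (EuclideanSpace.single i (1 : ℝ)) =
        scalarPartial S i Ψ x := by
      rw [gradientWithin, InnerProductSpace.toDual_symm_apply, scalarPartial]
    rw [← h1, EuclideanSpace.inner_single_right, one_mul, RCLike.conj_to_real]
  ext i
  rw [h]
  fin_cases i <;> rfl

theorem norm_gradientWithin_sq (S : Set Plane) (Ψ : Plane → ℝ) (x : Plane) :
    ‖gradientWithin Ψ S x‖ ^ 2 = scalarPartial S 0 Ψ x ^ 2 + scalarPartial S 1 Ψ x ^ 2 := by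
  rw [gradientWithin_eq, EuclideanSpace.norm_sq_eq]
  simp

/-- Testing positivity on `v = ∇Ψ` gives `0 < |v|² - |v|⁴`. -/
theorem IsSpacelikeOn.norm_gradientWithin_lt_one {S : Set Plane} (hu : UniqueDiffOn ℝ S)
    {Ψ : Plane → ℝ} (hΨ : ContDiffOn ℝ 1 Ψ S) (h : IsSpacelikeOn (graphMap Ψ) S) {x : Plane}
    (hx : x ∈ S) : ‖gradientWithin Ψ S x‖ < 1 := by
  set v := gradientWithin Ψ S x with hv
  by_cases hv0 : v = 0
  · simp [hv0]
  have h1 := h x hx v hv0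
  have h2 : fderivWithin ℝ Ψ S x v = ‖v‖ ^ 2 := by
    rw [← real_inner_self_eq_norm_sq]
    nth_rw 2 [hv]
    rw [gradientWithin, InnerProductSpace.toDual_symm_apply]
  have h3 : ‖v‖ ^ 2 = v 0 ^ 2 + v 1 ^ 2 := by
    rw [EuclideanSpace.norm_sq_eq]; simp
  rw [fderivWithin_graphMap hu hΨ hx, h2] at h1
  simp only [lorentzInner] at h1
  simp at h1
  have hpos : 0 < ‖v‖ := norm_pos_iff.2 hv0
  have h4 : ‖v‖ ^ 2 * ‖v‖ ^ 2 < ‖v‖ ^ 2 * 1 := by nlinarith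
  have h5 := lt_of_mul_lt_mul_left h4 (by positivity)
  nlinarith

/-! ### The curvature field and its divergence. -/

/-- The field `∇Ψ / √(1 - |∇Ψ|²)`, whose divergence is twice the mean curvature of the graph. -/
noncomputable def curvatureField (S : Set Plane) (Ψ : Plane → ℝ) (x : Plane) : Plane :=
  (√(1 - scalarPartial S 0 Ψ x ^ 2 - scalarPartial S 1 Ψ x ^ 2))⁻¹ •
    !₂[scalarPartial S 0 Ψ x, scalarPartial S 1 Ψ x]

theorem contDiffOn_curvatureField {S : Set Plane} (hu : UniqueDiffOn ℝ S)
    {Ψ : Plane → ℝ} (hΨ : ContDiffOn ℝ 2 Ψ S)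
    (hw : ∀ x ∈ S, 0 < 1 - scalarPartial S 0 Ψ x ^ 2 - scalarPartial S 1 Ψ x ^ 2) :
    ContDiffOn ℝ 1 (curvatureField S Ψ) S := by
  have h1 : ∀ i, ContDiffOn ℝ 1 (scalarPartial S i Ψ) S := fun i =>
    contDiffOn_scalarPartial hu hΨ (by norm_num) i
  have hwc : ContDiffOn ℝ 1
      (fun x => 1 - scalarPartial S 0 Ψ x ^ 2 - scalarPartial S 1 Ψ x ^ 2) S :=
    (contDiffOn_const.sub ((h1 0).pow 2)).sub ((h1 1).pow 2)
  refine ((hwc.sqrt fun x hx => (hw x hx).ne').inv fun x hx =>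
    (Real.sqrt_pos.2 (hw x hx)).ne').smul ?_
  refine contDiffOn_euclidean.2 fun k => ?_
  fin_cases k
  · exact h1 0
  · exact h1 1

/-- Each diagonal term of `div F` has this form along a coordinate line: `P` is the partial of `Ψ`
in that direction and `Q` the other one. -/
theorem hasDerivAt_inv_sqrt_mul {P Q : ℝ → ℝ} {a b t : ℝ} (hP : HasDerivAt P a t)
    (hQ : HasDerivAt Q b t) (hw : 0 < 1 - P t ^ 2 - Q t ^ 2) :
    HasDerivAt (fun t => (√(1 - P t ^ 2 - Q t ^ 2))⁻¹ * P t)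
      ((√(1 - P t ^ 2 - Q t ^ 2))⁻¹ * (a * (1 - Q t ^ 2) + P t * Q t * b) /
        (1 - P t ^ 2 - Q t ^ 2)) t := by
  have h1 : HasDerivAt (fun t => 1 - P t ^ 2 - Q t ^ 2) (-(2 * P t * a) - 2 * Q t * b) t :=
    (((hP.fun_pow 2).const_sub 1).fun_sub (hQ.fun_pow 2)).congr_deriv (by simp)
  have hs : √(1 - P t ^ 2 - Q t ^ 2) ≠ 0 := (Real.sqrt_pos.2 hw).ne'
  refine (((h1.sqrt hw.ne').fun_inv hs).fun_mul hP).congr_deriv ?_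
  have h2 := Real.sq_sqrt hw.le
  rw [h2]
  field_simp
  ring

/-- The divergence produces both mixed partials, whereas `meanCurvature` uses a single one twice. -/
theorem scalarPartial_comm {Ω : Set Plane} (hΩ : IsOpen Ω) {Ψ : Plane → ℝ}
    (hΨ : ContDiffOn ℝ 2 Ψ (closure Ω)) {x : Plane} (hx : x ∈ Ω) (i j : Fin 2) :
    scalarPartial (closure Ω) i (scalarPartial (closure Ω) j Ψ) x =
      scalarPartial (closure Ω) j (scalarPartial (closure Ω) i Ψ) x := by
  have hn : ∀ y ∈ Ω, closure Ω ∈ 𝓝 y := fun y hy =>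
    mem_of_superset (hΩ.mem_nhds hy) subset_closure
  have hc : ContDiffAt ℝ 2 Ψ x := hΨ.contDiffAt (hn x hx)
  have hd : DifferentiableAt ℝ (fderiv ℝ Ψ) x :=
    (hc.fderiv_right (m := 1) (by norm_num)).differentiableAt (by simp)
  have h1 : ∀ i j, scalarPartial (closure Ω) i (scalarPartial (closure Ω) j Ψ) x =
      fderiv ℝ (fderiv ℝ Ψ) x (EuclideanSpace.single i 1) (EuclideanSpace.single j 1) := by
    intro i j
    have he : scalarPartial (closure Ω) j Ψ =ᶠ[𝓝 x]
        fun y => fderiv ℝ Ψ y (EuclideanSpace.single j 1) := by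
      filter_upwards [hΩ.mem_nhds hx] with y hy
      rw [scalarPartial, fderivWithin_of_mem_nhds (hn y hy)]
    rw [scalarPartial, fderivWithin_of_mem_nhds (hn x hx), he.fderiv_eq,
      fderiv_clm_apply hd (differentiableAt_const _)]
    simp
  rw [h1, h1]
  exact (hc.isSymmSndFDerivAt (by simp)).eq _ _

theorem divergence_curvatureField {Ω : Set Plane} (hΩ : IsOpen Ω)
    (hu : UniqueDiffOn ℝ (closure Ω)) {Ψ : Plane → ℝ} (hΨ : ContDiffOn ℝ 2 Ψ (closure Ω))
    (hw : ∀ x ∈ closure Ω,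
      0 < 1 - scalarPartial (closure Ω) 0 Ψ x ^ 2 - scalarPartial (closure Ω) 1 Ψ x ^ 2)
    {x : Plane} (hx : x ∈ Ω) :
    divergence (curvatureField (closure Ω) Ψ) x =
      2 * meanCurvature (graphMap Ψ) (closure Ω) x := by
  set S := closure Ω with hS
  have hxS : x ∈ S := subset_closure hx
  have hn : S ∈ 𝓝 x := mem_of_superset (hΩ.mem_nhds hx) subset_closure
  have hF : DifferentiableAt ℝ (curvatureField S Ψ) x :=
    ((contDiffOn_curvatureField hu hΨ hw).contDiffAt hn).differentiableAt (by simp)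
  have hp : ∀ i j, HasDerivAt
      (fun t : ℝ => scalarPartial S i Ψ (x + t • EuclideanSpace.single j (1 : ℝ)))
      (scalarPartial S j (scalarPartial S i Ψ) x) 0 := fun i j => by
    have h1 : DifferentiableAt ℝ (scalarPartial S i Ψ) x :=
      ((contDiffOn_scalarPartial hu hΨ (m := 1) (by norm_num) i).contDiffAt hn).differentiableAt
        (by simp)
    have h2 := h1.hasFDerivAt.hasLineDerivAt (EuclideanSpace.single j (1 : ℝ))
    rw [scalarPartial, fderivWithin_of_mem_nhds hn]
    exact h2
  have hline : ∀ j, HasDerivAt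
      (fun t : ℝ => curvatureField S Ψ (x + t • EuclideanSpace.single j (1 : ℝ)) j)
      (fderiv ℝ (curvatureField S Ψ) x (EuclideanSpace.single j 1) j) 0 := fun j => by
    have h1 : HasDerivAt (fun t : ℝ => curvatureField S Ψ (x + t • EuclideanSpace.single j (1 : ℝ)))
      (fderiv ℝ (curvatureField S Ψ) x (EuclideanSpace.single j 1)) 0 :=
      hF.hasFDerivAt.hasLineDerivAt (EuclideanSpace.single j (1 : ℝ))
    exact (EuclideanSpace.proj (𝕜 := ℝ) j).hasFDerivAt.comp_hasDerivAt (0 : ℝ) h1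
  have hwx := hw x hxS
  have h0 := (hline 0).unique (hasDerivAt_inv_sqrt_mul (hp 0 0) (hp 1 0) (by simpa using hwx))
  -- Here `P` and `Q` exchange roles, so the two squares under the root must be reordered.
  have h1 := (hline 1).unique ((hasDerivAt_inv_sqrt_mul (hp 1 1) (hp 0 1)
    (by simp only [zero_smul, add_zero]; linarith)).congr_of_eventuallyEq
      (Eventually.of_forall fun t => by
        simp only [curvatureField, sub_right_comm]
        rfl))
  simp only [zero_smul, add_zero] at h0 h1
  rw [divergence_eq_sum_inner (EuclideanSpace.basisFun (Fin 2) ℝ), meanCurvature_graphMap hu hΨ hxS]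
  simp only [EuclideanSpace.basisFun_apply, EuclideanSpace.inner_single_left, map_one, one_mul]
  rw [h0, h1, scalarPartial_comm hΩ hΨ hx 0 1, sub_right_comm (1 : ℝ) (scalarPartial S 1 Ψ x ^ 2)]
  have := hwx.ne'
  field_simp
  ring

theorem norm_curvatureField_le {S : Set Plane} {Ψ : Plane → ℝ} {x : Plane} {m : ℝ}
    (hx : ‖gradientWithin Ψ S x‖ ≤ m) (hm : m < 1) :
    ‖curvatureField S Ψ x‖ ≤ m / √(1 - m ^ 2) := by
  have h0 := norm_nonneg (gradientWithin Ψ S x)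
  have hw : 1 - scalarPartial S 0 Ψ x ^ 2 - scalarPartial S 1 Ψ x ^ 2 =
      1 - ‖gradientWithin Ψ S x‖ ^ 2 := by
    rw [norm_gradientWithin_sq]; ring
  rw [curvatureField, ← gradientWithin_eq, hw, norm_smul, norm_inv,
    Real.norm_of_nonneg (Real.sqrt_nonneg _), inv_mul_eq_div]
  have hm2 : 0 < 1 - m ^ 2 := by nlinarith
  exact div_le_div₀ (h0.trans hx) hx (Real.sqrt_pos.2 hm2) (Real.sqrt_le_sqrt (by nlinarith))

/-! ### Constant sign of the curvature and conclusion. -/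

/-- `H` has no zero, so by the intermediate value theorem it keeps one sign and no cancellation
occurs in the integral. -/
theorem mul_volume_le_abs_setIntegral {Ω : Set Plane} (hΩ : IsOpen Ω) (hconn : IsPreconnected Ω)
    (hfin : volume Ω < ⊤) {H : Plane → ℝ} (hH : ContinuousOn H Ω) (hi : IntegrableOn H Ω) {h : ℝ}
    (hh : ∀ x ∈ Ω, h ≤ |H x|) (hpos : 0 < h) : h * volume.real Ω ≤ |∫ x in Ω, H x| := by
  have hne : ∀ x ∈ Ω, H x ≠ 0 := fun x hx h0 => by
    have := hh x hx
    rw [h0, abs_zero] at this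
    linarith
  have key : ∀ K : Plane → ℝ, IntegrableOn K Ω → (∀ x ∈ Ω, h ≤ K x) →
      h * volume.real Ω ≤ ∫ x in Ω, K x := fun K hK hle => by
    have := setIntegral_mono_on (integrableOn_const hfin.ne) hK hΩ.measurableSet hle
    rwa [setIntegral_const, smul_eq_mul, mul_comm] at this
  by_cases hall : ∀ x ∈ Ω, 0 < H x
  · refine (key H hi fun x hx => ?_).trans (le_abs_self _)
    simpa [abs_of_pos (hall x hx)] using hh x hx
  · push Not at hall
    obtain ⟨y, hy, hy0⟩ := hall
    have hneg : ∀ x ∈ Ω, H x < 0 := fun x hx => by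
      by_contra! hx0
      obtain ⟨z, hz, hz0⟩ := hconn.intermediate_value hy hx hH ⟨hy0, hx0⟩
      exact hne z hz hz0
    refine (key (fun x => -H x) hi.neg fun x hx => ?_).trans ?_
    · simpa [abs_of_neg (hneg x hx)] using hh x hx
    · rw [integral_neg]
      exact neg_le_abs _

theorem proposition3p5 (Ω : Set (EuclideanSpace ℝ (Fin 2)))
    (hΩ_open : IsOpen Ω) (hΩ_conn : IsConnected Ω) (hΩ_compact : IsCompact (closure Ω))
    (hΩ_smooth : HasSmoothBoundary Ω)
    (Ψ : EuclideanSpace ℝ (Fin 2) → ℝ) (hΨ : ContDiffOn ℝ 2 Ψ (closure Ω))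
    (hspace : IsSpacelikeOn (graphMap Ψ) (closure Ω)) :
    ∃ m h : ℝ,
      IsGreatest ((fun x => ‖gradientWithin Ψ (closure Ω) x‖) '' closure Ω) m ∧ m < 1 ∧
      IsLeast ((fun x => |meanCurvature (graphMap Ψ) (closure Ω) x|) '' closure Ω) h ∧
      Measure.hausdorffMeasure 1 (frontier Ω) < ⊤ ∧
      h ≤ 1 / 2 * (m / √(1 - m ^ 2)) *
        ((Measure.hausdorffMeasure 1).real (frontier Ω) / volume.real (closure Ω)) := by
  have hu := hΩ_smooth.uniqueDiffOn_closure hΩ_open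
  have hfin := hausdorffMeasure_frontier_lt_top hΩ_open hΩ_compact hΩ_smooth
  have hne : (closure Ω).Nonempty := hΩ_conn.nonempty.closure
  have hΨ1 : ContDiffOn ℝ 1 Ψ (closure Ω) := hΨ.of_le (by norm_num)
  have hlt : ∀ x ∈ closure Ω, ‖gradientWithin Ψ (closure Ω) x‖ < 1 := fun x hx =>
    hspace.norm_gradientWithin_lt_one hu hΨ1 hx
  have hw : ∀ x ∈ closure Ω,
      0 < 1 - scalarPartial (closure Ω) 0 Ψ x ^ 2 - scalarPartial (closure Ω) 1 Ψ x ^ 2 := by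
    intro x hx
    have h1 := norm_gradientWithin_sq (closure Ω) Ψ x
    have h2 := hlt x hx
    have h3 := norm_nonneg (gradientWithin Ψ (closure Ω) x)
    nlinarith
  have hgc : ContinuousOn (fun x => ‖gradientWithin Ψ (closure Ω) x‖) (closure Ω) :=
    ((InnerProductSpace.toDual ℝ Plane).symm.continuous.comp_continuousOn
      (hΨ1.continuousOn_fderivWithin hu le_rfl)).norm
  have hHc := continuousOn_meanCurvature_graphMap hu hΨ hw
  obtain ⟨m, hm⟩ := (hΩ_compact.image_of_continuousOn hgc).exists_isGreatest (hne.image _)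
  obtain ⟨h, hh⟩ := (hΩ_compact.image_of_continuousOn hHc.abs).exists_isLeast (hne.image _)
  have hm1 : m < 1 := by
    obtain ⟨x, hx, rfl⟩ := hm.1
    exact hlt x hx
  have hm0 : 0 ≤ m := by
    obtain ⟨x, hx, rfl⟩ := hm.1
    exact norm_nonneg _
  have hh0 : 0 ≤ h := by
    obtain ⟨x, hx, rfl⟩ := hh.1
    exact abs_nonneg _
  refine ⟨m, h, hm, hm1, hh, hfin, ?_⟩
  set M := m / √(1 - m ^ 2) with hM
  have hM0 : 0 ≤ M := by positivity
  -- For `h = 0` the curvature may change sign, but the right side is nonnegative.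
  rcases hh0.eq_or_lt with hzero | hpos
  · rw [← hzero]
    positivity
  have hflux := abs_setIntegral_divergence_le hΩ_open hΩ_compact hΩ_smooth
    (contDiffOn_curvatureField hu hΨ hw) hM0 fun x hx =>
      norm_curvatureField_le (hm.2 (mem_image_of_mem _ (frontier_subset_closure hx))) hm1
  rw [setIntegral_congr_fun hΩ_open.measurableSet fun x hx =>
    divergence_curvatureField hΩ_open hu hΨ hw hx, integral_const_mul, abs_mul, abs_two] at hflux
  have hvol : volume.real (closure Ω) = volume.real Ω := by
    rw [measureReal_def, measureReal_def, measure_closure_of_null_frontier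
      (volume_eq_zero_of_hausdorffMeasure_one_lt_top hfin)]
  have hΩfin : volume Ω < ⊤ := (measure_mono subset_closure).trans_lt hΩ_compact.measure_lt_top
  have hA : 0 < volume.real Ω :=
    ENNReal.toReal_pos (hΩ_open.measure_pos volume hΩ_conn.nonempty).ne' hΩfin.ne
  have hlow := mul_volume_le_abs_setIntegral hΩ_open hΩ_conn.isPreconnected hΩfin
    (hHc.mono subset_closure) ((hHc.integrableOn_compact hΩ_compact).mono_set subset_closure)
    (fun x hx => hh.2 (mem_image_of_mem _ (subset_closure hx))) hpos
  rw [hvol, ← mul_div_assoc, le_div_iff₀ hA]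
  linarith
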